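/- All graphs are finite and directed, with loops and multiple edges allowed. For a vertex $I$ of a graph $G$ let $E_I(G)$ be the set of edges leaving $I$, let $E_I^J(G)$ be the set of edges from $I$ to $J$, and let $F(I)$ be the set of terminal vertices of the edges in $E_I(G)$. $G$ is strongly connected if for every ordered pair of vertices $(I,J)$ there is a directed path (possibly of length $0$) from $I$ to $J$. A right resolver $\Phi:G\to H$ is a surjective graph homomorphism, with vertex map $\partial\Phi$, whose restriction $E_I(G)\to E_{\partial\Phi(I)}(H)$ is a bijection for every vertex $I$ of $G$. For a path $w$ of $H$ starting at $\partial\Phi(I)$, let $I\cdot_\Phi w$ be the terminal vertex of the unique path of $G$ that starts at $I$ and is mapped to $w$. Vertices $I_1,I_2$ with $\partial\Phi(I_1)=\partial\Phi(I_2)$ are stably related, $I_1\sim_\Phi I_2$, if for every path $u$ of $H$ starting at $\partial\Phi(I_1)$ there is a path $v$ of $H$ starting at the end of $u$ with $I_1\cdot_\Phi uv=I_2\cdot_\Phi uv$. The right resolver $\Phi$ is synchronizing if $I_1\sim_\Phi I_2$ whenever $\partial\Phi(I_1)=\partial\Phi(I_2)$. Write $H\le_R G$ if there is a right resolver $G\to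 H$, and $H\le_S G$ if there is a synchronizing right resolver $G\to H$; both are partial orders on isomorphism classes of graphs. A graph is $\le_R$-minimal (respectively $\le_S$-minimal) if every graph below it for $\le_R$ (respectively $\le_S$) is isomorphic to it. Every graph $G$ has a $\le_R$-minimal graph $M(G)\le_R G$, unique up to isomorphism, and all right resolvers $G\to M(G)$ have the same vertex map $\Sigma_G$. The graph $G$ is weakly almost bunchy if for all vertices $I,J$ of $M(G)$ with $|E_I^J(M(G))|\ge 2$ there is at most one vertex $I'\in\Sigma_G^{-1}(I)$ with $|\Sigma_G^{-1}(J)\cap F(I')|=|E_I^J(M(G))|$. **Proposition.** Let $G$ be a strongly connected weakly almost bunchy graph. Then there is a $\le_S$-minimal graph $O(G)$ with $O(G)\le_S G$, and it is unique: every $\le_S$-minimal graph $H$ with $H\le_S G$ is isomorphic to $O(G)$. That is, the $O(G)$ conjecture holds for $G$. -/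

import Mathlib

universe u

/-- A finite directed graph; loops and multiple edges are allowed. -/
structure FinDigraph where
  /-- vertices -/
  V : Type u
  /-- edges -/
  E : Type u
  /-- initial vertex of an edge -/
  src : E → V
  /-- terminal vertex of an edge -/
  tgt : E → V
  finV : Finite V
  finE : Finite E

namespace FinDigraph

attribute [instance] FinDigraph.finV FinDigraph.finE

/-- The set of edges leaving the vertex `I`. -/
def outEdges (G : FinDigraph.{u}) (I : G.V) : Set G.E := {e | G.src e = I}

/-- The set of edges from `I` to `J`. -/
def edgesBetween (G : FinDigraph.{u}) (I J : G.V) : Set G.E := {e | G.src e = I ∧ G.tgt e = J}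

/-- The follower states of `I`: the terminal vertices of the edges leaving `I`. -/
def followers (G : FinDigraph.{u}) (I : G.V) : Set G.V := G.tgt '' G.outEdges I

/-- `G.IsPath I p J` says that the list `p` of edges is a path from `I` to `J`; the empty list is
the path of length zero from `I` to `I`. -/
def IsPath (G : FinDigraph.{u}) : G.V → List G.E → G.V → Prop
  | I, [], J => I = J
  | I, e :: p, J => G.src e = I ∧ G.IsPath (G.tgt e) p J

/-- There is a directed path from every vertex to every vertex. -/
def StronglyConnected (G : FinDigraph.{u}) : Prop :=
  ∀ I J : G.V, ∃ p : List G.E, G.IsPath I p J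

/-- A graph homomorphism. -/
structure Hom (G H : FinDigraph.{u}) where
  /-- vertex map -/
  onV : G.V → H.V
  /-- edge map -/
  onE : G.E → H.E
  src_onE : ∀ e, H.src (onE e) = onV (G.src e)
  tgt_onE : ∀ e, H.tgt (onE e) = onV (G.tgt e)

/-- Isomorphism of graphs. -/
def Isomorphic (G H : FinDigraph.{u}) : Prop :=
  ∃ Φ : Hom G H, Function.Bijective Φ.onV ∧ Function.Bijective Φ.onE

/-- A right resolver: a surjective homomorphism that maps the edges leaving any vertex `I`
bijectively onto the edges leaving the image of `I`. -/
structure Hom.IsRightResolver {G H : FinDigraph.{u}} (Φ : Hom G H) : Prop where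
  surjective_onV : Function.Surjective Φ.onV
  surjective_onE : Function.Surjective Φ.onE
  bijOn : ∀ I : G.V, Set.BijOn Φ.onE (G.outEdges I) (H.outEdges (Φ.onV I))

/-- `Φ.LiftsTo I w J` says that the path `w` of `H` lifts to a path of `G` from `I` to `J`.
For a right resolver `Φ` and a path `w` starting at the image of `I`, there is exactly one such
lift (`Hom.IsRightResolver.existsUnique_lift`), so this says that `J` is the vertex `I · w`. -/
def Hom.LiftsTo {G H : FinDigraph.{u}} (Φ : Hom G H) (I : G.V) (w : List H.E) (J : G.V) : Prop :=
  ∃ p : List G.E, G.IsPath I p J ∧ p.map Φ.onE = w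

theorem Hom.IsRightResolver.existsUnique_lift {G H : FinDigraph.{u}} {Φ : Hom G H}
    (hΦ : Φ.IsRightResolver) (I : G.V) (w : List H.E) (K : H.V) (hw : H.IsPath (Φ.onV I) w K) :
    ∃! x : List G.E × G.V, G.IsPath I x.1 x.2 ∧ x.1.map Φ.onE = w := by
  induction w generalizing I with
  | nil =>
    refine ⟨([], I), ⟨rfl, rfl⟩, ?_⟩
    rintro ⟨p, J⟩ ⟨hp, hm⟩
    obtain rfl : p = [] := List.map_eq_nil_iff.1 hm
    have hIJ : I = J := hp
    rw [hIJ]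
  | cons e w ih =>
    obtain ⟨he, hw⟩ := hw
    obtain ⟨a, ha, rfl⟩ := (hΦ.bijOn I).surjOn (show e ∈ H.outEdges (Φ.onV I) from he)
    rw [Φ.tgt_onE] at hw
    obtain ⟨⟨p, J⟩, ⟨hp, hm⟩, huniq⟩ := ih (G.tgt a) hw
    refine ⟨(a :: p, J), ⟨⟨ha, hp⟩, by simpa using hm⟩, ?_⟩
    rintro ⟨r, L⟩ ⟨hq, hr⟩
    obtain ⟨b, q, rfl, hb, hqm⟩ := List.map_eq_cons_iff.1 hr
    obtain ⟨hbI, hq⟩ := hq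
    obtain rfl : b = a := (hΦ.bijOn I).injOn hbI ha hb
    have h := huniq (q, L) ⟨hq, hqm⟩
    rw [Prod.mk.injEq] at h
    rw [h.1, h.2]

/-- The stability relation of `Φ`: the vertices `I₁` and `I₂` lie in the same fiber, and every
path `u` of `H` starting at their common image extends to a path `u v` with
`I₁ · (u v) = I₂ · (u v)`. -/
def Hom.Stable {G H : FinDigraph.{u}} (Φ : Hom G H) (I₁ I₂ : G.V) : Prop :=
  Φ.onV I₁ = Φ.onV I₂ ∧
    ∀ (u : List H.E) (K : H.V), H.IsPath (Φ.onV I₁) u K →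
      ∃ (v : List H.E) (L : H.V), H.IsPath K v L ∧
        ∃ J : G.V, Φ.LiftsTo I₁ (u ++ v) J ∧ Φ.LiftsTo I₂ (u ++ v) J

/-- A synchronizing right resolver: the stability classes are the entire fibers. -/
def Hom.IsSynchronizing {G H : FinDigraph.{u}} (Φ : Hom G H) : Prop :=
  Φ.IsRightResolver ∧ ∀ I₁ I₂ : G.V, Φ.onV I₁ = Φ.onV I₂ → Φ.Stable I₁ I₂

/-- `H ≤_R G`: there is a right resolver from `G` to `H`. -/
def LeR (H G : FinDigraph.{u}) : Prop := ∃ Φ : Hom G H, Φ.IsRightResolver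

/-- `H ≤_S G`: there is a synchronizing right resolver from `G` to `H`. -/
def LeS (H G : FinDigraph.{u}) : Prop := ∃ Φ : Hom G H, Φ.IsSynchronizing

/-- Minimality for `≤_R`, on graphs up to isomorphism. -/
def IsMinimalR (M : FinDigraph.{u}) : Prop := ∀ K : FinDigraph.{u}, LeR K M → Isomorphic K M

/-- Minimality for `≤_S`, on graphs up to isomorphism. -/
def IsMinimalS (H : FinDigraph.{u}) : Prop := ∀ K : FinDigraph.{u}, LeS K H → Isomorphic K H

/-- `G` is weakly almost bunchy: with `M = M(G)` the `≤_R`-minimal right resolving factor of `G`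
and `Σ_G` the vertex map of a right resolver `Φ : G → M`, for all vertices `I`, `J` of `M` with at
least two edges from `I` to `J` there is at most one `I'` over `I` having as many follower states
over `J` as there are edges from `I` to `J`. Since `M(G)` is unique up to isomorphism and `Σ_G` does
not depend on the right resolver, the choice of `M` and `Φ` is immaterial. -/
def WeaklyAlmostBunchy (G : FinDigraph.{u}) : Prop :=
  ∃ (M : FinDigraph.{u}) (Φ : Hom G M), M.IsMinimalR ∧ Φ.IsRightResolver ∧
    ∀ I J : M.V, 2 ≤ (M.edgesBetween I J).ncard →
      {I' : G.V | Φ.onV I' = I ∧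
        (Φ.onV ⁻¹' {J} ∩ G.followers I').ncard = (M.edgesBetween I J).ncard}.Subsingleton

end FinDigraph

/-!
Existence of a `≤_S`-minimal graph below `G` is clear: among the graphs below `G` for `≤_S`, take
one with the fewest vertices. For uniqueness, all right resolvers onto graphs below `G` are compared
over the `≤_R`-minimal factor `M` of `G`: by `IsMinimalR.exists_factor`, if `Ψ : G → H` is a right
resolver, then `H` has a right resolver `Θ` to `M` such that `Θ` after `Ψ` is `Σ_G` on vertices. The
proof rests on two facts.

*A `≤_S`-minimal graph `H` below `G` is bunchy over `M`*: all edges from a vertex of `H` into one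
fiber over `M` have the same terminal vertex. First, `H` inherits weak almost bunchiness. Suppose
that it is not bunchy at `I`, `J`. Then for a suitable vertex `p` over `I`, every other vertex over
`I` has two edges over `J` with the same end, while `p` has two with different ends. After permuting
parallel edges, the two chosen edges at each vertex over `I` map to one fixed pair `x`, `y`. Call
a set of vertices in one fiber a clique if no two of them can be merged. Since `H` is strongly
connected, some clique `A` of maximum size contains `p`, and `A · x` and `A · y` are maximum cliques
that differ in exactly one vertex. This forces `p · x` and `p · y` to be stable
(`stable_of_isMaxClique`), since a path taking them to a non-mergeable pair would take the union of
both cliques to a larger one. Stability is a congruence, so the quotient by it is a proper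
synchronizing factor of `H` (`IsMinimalS.eq_of_stable`), against minimality.

*Bunchy graphs do not see edge labels*: the lift of a path of `M` to a bunchy graph runs through
vertices determined by the vertices of the path. Hence, if `H₁` and `H₂` are synchronizing factors
of `G` and `H₂` is bunchy, vertices of `G` with the same image in `H₁` have stable images in `H₂`
(`IsBunchy.stable_of_isSynchronizing`), and these images are equal if `H₂` is `≤_S`-minimal. So the
vertex maps from `G` to two `≤_S`-minimal graphs below it have the same fibers, and the fibers
determine the graph (`Isomorphic.of_ker_eq`).
-/

namespace FinDigraph

variable {G H K M : FinDigraph.{u}}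

/-! ### Paths and lifts -/

theorem isPath_append {I K : G.V} {p q : List G.E} :
    G.IsPath I (p ++ q) K ↔ ∃ J, G.IsPath I p J ∧ G.IsPath J q K := by
  induction p generalizing I with
  | nil => simp [IsPath]
  | cons e p ih => simp [IsPath, ih, and_assoc]

theorem IsPath.tgt_unique {I J K : G.V} {p : List G.E} (hJ : G.IsPath I p J)
    (hK : G.IsPath I p K) : J = K := by
  induction p generalizing I with
  | nil => exact Eq.trans (Eq.symm hJ) hK
  | cons e p ih => exact ih hJ.2 hK.2

theorem Hom.isPath_map (Φ : Hom G H) {I J : G.V} {p : List G.E} (hp : G.IsPath I p J) :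
    H.IsPath (Φ.onV I) (p.map Φ.onE) (Φ.onV J) := by
  induction p generalizing I with
  | nil => exact congrArg Φ.onV hp
  | cons e p ih =>
    obtain ⟨rfl, hp⟩ := hp
    refine ⟨Φ.src_onE e, ?_⟩
    rw [Φ.tgt_onE]
    exact ih hp

theorem Hom.liftsTo_append {Φ : Hom G H} {I K : G.V} {u v : List H.E} :
    Φ.LiftsTo I (u ++ v) K ↔ ∃ J, Φ.LiftsTo I u J ∧ Φ.LiftsTo J v K := by
  constructor
  · rintro ⟨p, hp, hm⟩
    obtain ⟨p₁, p₂, rfl, rfl, rfl⟩ := List.map_eq_append_iff.1 hm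
    obtain ⟨J, h₁, h₂⟩ := isPath_append.1 hp
    exact ⟨J, ⟨p₁, h₁, rfl⟩, ⟨p₂, h₂, rfl⟩⟩
  · rintro ⟨J, ⟨p₁, h₁, rfl⟩, ⟨p₂, h₂, rfl⟩⟩
    exact ⟨p₁ ++ p₂, isPath_append.2 ⟨J, h₁, h₂⟩, List.map_append⟩

theorem Hom.liftsTo_singleton {Φ : Hom G H} {a : G.E} :
    Φ.LiftsTo (G.src a) [Φ.onE a] (G.tgt a) :=
  ⟨[a], ⟨rfl, rfl⟩, rfl⟩

theorem Hom.LiftsTo.isPath {Φ : Hom G H} {I J : G.V} {w : List H.E} (h : Φ.LiftsTo I w J) :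
    H.IsPath (Φ.onV I) w (Φ.onV J) := by
  obtain ⟨p, hp, rfl⟩ := h
  exact Φ.isPath_map hp

namespace Hom.IsRightResolver

variable {Φ : Hom G H}

theorem liftsTo_unique (hΦ : Φ.IsRightResolver) {I J J' : G.V} {w : List H.E}
    (h : Φ.LiftsTo I w J) (h' : Φ.LiftsTo I w J') : J = J' := by
  obtain ⟨p, hp, hpw⟩ := id h
  obtain ⟨q, hq, hqw⟩ := h'
  have := (hΦ.existsUnique_lift I w _ h.isPath).unique (y₁ := (p, J)) (y₂ := (q, J'))
    ⟨hp, hpw⟩ ⟨hq, hqw⟩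
  exact congrArg Prod.snd this

theorem exists_liftsTo (hΦ : Φ.IsRightResolver) {I : G.V} {w : List H.E} {L : H.V}
    (hw : H.IsPath (Φ.onV I) w L) : ∃ J, Φ.LiftsTo I w J ∧ Φ.onV J = L := by
  obtain ⟨⟨p, J⟩, ⟨hp, hpw⟩, -⟩ := hΦ.existsUnique_lift I w L hw
  have h : Φ.LiftsTo I w J := ⟨p, hp, hpw⟩
  exact ⟨J, h, h.isPath.tgt_unique hw⟩

theorem exists_edge (hΦ : Φ.IsRightResolver) {I : G.V} {x : H.E} (hx : H.src x = Φ.onV I) :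
    ∃ a, G.src a = I ∧ Φ.onE a = x :=
  (hΦ.bijOn I).surjOn hx

theorem edge_unique (hΦ : Φ.IsRightResolver) {a b : G.E} (hs : G.src a = G.src b)
    (h : Φ.onE a = Φ.onE b) : a = b :=
  (hΦ.bijOn (G.src b)).injOn hs rfl h

/-- Surjectivity on edges is automatic: every edge of `H` leaves the image of some vertex. -/
theorem of_bijOn (hV : Function.Surjective Φ.onV)
    (h : ∀ I, Set.BijOn Φ.onE (G.outEdges I) (H.outEdges (Φ.onV I))) : Φ.IsRightResolver where
  surjective_onV := hV
  surjective_onE x := by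
    obtain ⟨I, hI⟩ := hV (H.src x)
    obtain ⟨a, -, ha⟩ := (h I).surjOn (show x ∈ H.outEdges _ from hI.symm)
    exact ⟨a, ha⟩
  bijOn := h

theorem of_existsUnique (hV : Function.Surjective Φ.onV)
    (hinj : ∀ a b, G.src a = G.src b → Φ.onE a = Φ.onE b → a = b)
    (hsurj : ∀ I x, H.src x = Φ.onV I → ∃ a, G.src a = I ∧ Φ.onE a = x) :
    Φ.IsRightResolver :=
  of_bijOn hV fun I =>
    ⟨fun a ha => (Φ.src_onE a).trans (congrArg Φ.onV ha),
      fun a ha b hb h => hinj a b (Eq.trans ha (Eq.symm hb)) h,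
      fun x hx => hsurj I x hx⟩

theorem bijective_onE (hΦ : Φ.IsRightResolver) (h : Function.Injective Φ.onV) :
    Function.Bijective Φ.onE := by
  refine ⟨fun a b hab => hΦ.edge_unique (h ?_) hab, hΦ.surjective_onE⟩
  rw [← Φ.src_onE, ← Φ.src_onE, hab]

end Hom.IsRightResolver

/-- Composition of graph homomorphisms. -/
def Hom.comp (Ψ : Hom H K) (Φ : Hom G H) : Hom G K where
  onV := Ψ.onV ∘ Φ.onV
  onE := Ψ.onE ∘ Φ.onE
  src_onE e := by simp [Ψ.src_onE, Φ.src_onE]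
  tgt_onE e := by simp [Ψ.tgt_onE, Φ.tgt_onE]

theorem Hom.IsRightResolver.comp {Ψ : Hom H K} {Φ : Hom G H} (hΨ : Ψ.IsRightResolver)
    (hΦ : Φ.IsRightResolver) : (Ψ.comp Φ).IsRightResolver :=
  .of_bijOn (hΨ.surjective_onV.comp hΦ.surjective_onV)
    fun I => (hΨ.bijOn (Φ.onV I)).comp (hΦ.bijOn I)

theorem Isomorphic.symm (h : G.Isomorphic H) : H.Isomorphic G := by
  obtain ⟨Φ, hV, hE⟩ := h
  refine ⟨⟨(Equiv.ofBijective _ hV).symm, (Equiv.ofBijective _ hE).symm, fun e => ?_, fun e => ?_⟩,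
    Equiv.bijective _, Equiv.bijective _⟩ <;>
  · obtain ⟨e, rfl⟩ := hE.2 e
    simp [Equiv.ofBijective_symm_apply_apply, Φ.src_onE, Φ.tgt_onE]

theorem StronglyConnected.of_surjective (hG : G.StronglyConnected) (Φ : Hom G H)
    (hΦ : Function.Surjective Φ.onV) : H.StronglyConnected := by
  intro I J
  obtain ⟨I, rfl⟩ := hΦ I
  obtain ⟨J, rfl⟩ := hΦ J
  obtain ⟨p, hp⟩ := hG I J
  exact ⟨_, Φ.isPath_map hp⟩

/-! ### Mergeable vertices and stability -/

/-- Two vertices are mergeable if some path of `H` takes both to the same vertex. -/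
def Hom.Mergeable (Φ : Hom G H) (I₁ I₂ : G.V) : Prop :=
  ∃ (v : List H.E) (J : G.V), Φ.LiftsTo I₁ v J ∧ Φ.LiftsTo I₂ v J

theorem Hom.mergeable_refl (Φ : Hom G H) (I : G.V) : Φ.Mergeable I I :=
  ⟨[], I, ⟨[], rfl, rfl⟩, ⟨[], rfl, rfl⟩⟩

theorem Hom.Mergeable.symm {Φ : Hom G H} {I₁ I₂ : G.V} (h : Φ.Mergeable I₁ I₂) :
    Φ.Mergeable I₂ I₁ := by
  obtain ⟨v, J, h₁, h₂⟩ := h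
  exact ⟨v, J, h₂, h₁⟩

theorem Hom.Mergeable.of_liftsTo {Φ : Hom G H} {I₁ I₂ J₁ J₂ : G.V} {u : List H.E}
    (h : Φ.Mergeable J₁ J₂) (h₁ : Φ.LiftsTo I₁ u J₁) (h₂ : Φ.LiftsTo I₂ u J₂) :
    Φ.Mergeable I₁ I₂ := by
  obtain ⟨v, J, hv₁, hv₂⟩ := h
  exact ⟨u ++ v, J, liftsTo_append.2 ⟨_, h₁, hv₁⟩, liftsTo_append.2 ⟨_, h₂, hv₂⟩⟩

theorem Hom.IsRightResolver.stable_iff {Φ : Hom G H} (hΦ : Φ.IsRightResolver) {I₁ I₂ : G.V} :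
    Φ.Stable I₁ I₂ ↔ Φ.onV I₁ = Φ.onV I₂ ∧ ∀ (u : List H.E) (J₁ J₂ : G.V),
      Φ.LiftsTo I₁ u J₁ → Φ.LiftsTo I₂ u J₂ → Φ.Mergeable J₁ J₂ := by
  refine and_congr_right fun hI => ⟨fun h u J₁ J₂ h₁ h₂ => ?_, fun h u L hu => ?_⟩
  · obtain ⟨v, L, -, J, hv₁, hv₂⟩ := h u _ h₁.isPath
    obtain ⟨K₁, hu₁, hv₁⟩ := liftsTo_append.1 hv₁
    obtain ⟨K₂, hu₂, hv₂⟩ := liftsTo_append.1 hv₂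
    obtain rfl := hΦ.liftsTo_unique h₁ hu₁
    obtain rfl := hΦ.liftsTo_unique h₂ hu₂
    exact ⟨v, J, hv₁, hv₂⟩
  · obtain ⟨J₁, h₁, rfl⟩ := hΦ.exists_liftsTo hu
    obtain ⟨J₂, h₂, -⟩ := hΦ.exists_liftsTo (hI ▸ hu)
    obtain ⟨v, J, hv₁, hv₂⟩ := h u J₁ J₂ h₁ h₂
    exact ⟨v, _, hv₁.isPath, J, liftsTo_append.2 ⟨_, h₁, hv₁⟩, liftsTo_append.2 ⟨_, h₂, hv₂⟩⟩

/-- Lifts of one path from two vertices of a fiber end in a common fiber, so mergeability within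
fibers already gives stability. -/
theorem Hom.isSynchronizing_iff {Φ : Hom G H} : Φ.IsSynchronizing ↔
    Φ.IsRightResolver ∧ ∀ I₁ I₂, Φ.onV I₁ = Φ.onV I₂ → Φ.Mergeable I₁ I₂ := by
  refine and_congr_right fun hΦ => ⟨fun h I₁ I₂ hI => ?_, fun h I₁ I₂ hI => ?_⟩
  · exact (hΦ.stable_iff.1 (h I₁ I₂ hI)).2 [] _ _ ⟨[], rfl, rfl⟩ ⟨[], rfl, rfl⟩
  · refine hΦ.stable_iff.2 ⟨hI, fun u J₁ J₂ h₁ h₂ => h _ _ ?_⟩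
    exact h₁.isPath.tgt_unique (hI ▸ h₂.isPath)

theorem Hom.LiftsTo.comp {Φ : Hom G H} {I J : G.V} {w : List H.E} (h : Φ.LiftsTo I w J)
    (Ψ : Hom H K) : (Ψ.comp Φ).LiftsTo I (w.map Ψ.onE) J := by
  obtain ⟨p, hp, rfl⟩ := h
  exact ⟨p, hp, by rw [List.map_map]; rfl⟩

theorem LeS.refl (G : FinDigraph.{u}) : LeS G G :=
  ⟨⟨id, id, fun _ => rfl, fun _ => rfl⟩, Hom.isSynchronizing_iff.2
    ⟨.of_bijOn Function.surjective_id fun _ => Set.bijOn_id _,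
      fun I₁ I₂ h => (show I₁ = I₂ from h) ▸ Hom.mergeable_refl _ _⟩⟩

theorem LeS.trans (hKH : LeS K H) (hHG : LeS H G) : LeS K G := by
  obtain ⟨Ψ, hΨ⟩ := hKH
  obtain ⟨Φ, hΦ⟩ := hHG
  rw [Hom.isSynchronizing_iff] at hΨ hΦ
  refine ⟨Ψ.comp Φ, Hom.isSynchronizing_iff.2 ⟨hΨ.1.comp hΦ.1, fun I₁ I₂ hI => ?_⟩⟩
  -- The images in `H` are merged first, the resulting vertices of one fiber of `Φ` next.
  obtain ⟨v, J, ⟨p₁, hp₁, rfl⟩, ⟨p₂, hp₂, hp⟩⟩ := hΨ.2 _ _ hI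
  obtain ⟨J₁, h₁, rfl⟩ := hΦ.1.exists_liftsTo hp₁
  obtain ⟨J₂, h₂, hJ⟩ := hΦ.1.exists_liftsTo hp₂
  obtain ⟨w, L, k₁, k₂⟩ := hΦ.2 _ _ hJ.symm
  exact Hom.Mergeable.of_liftsTo ⟨_, L, k₁.comp Ψ, k₂.comp Ψ⟩ (h₁.comp Ψ) (hp ▸ h₂.comp Ψ)

theorem Hom.IsRightResolver.stable_trans {Φ : Hom G H} (hΦ : Φ.IsRightResolver) {I₁ I₂ I₃ : G.V}
    (h₁₂ : Φ.Stable I₁ I₂) (h₂₃ : Φ.Stable I₂ I₃) : Φ.Stable I₁ I₃ := by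
  have h₁₂' := hΦ.stable_iff.1 h₁₂
  have h₂₃' := hΦ.stable_iff.1 h₂₃
  refine hΦ.stable_iff.2 ⟨h₁₂.1.trans h₂₃.1, fun u J₁ J₃ h₁ h₃ => ?_⟩
  obtain ⟨J₂, h₂, hJ⟩ := hΦ.exists_liftsTo (I := I₂) (h₁₂.1 ▸ h₁.isPath)
  -- `J₁` and `J₂` are merged along `v`; the continuation `w` merges `J₂ · v` with `J₃ · v`.
  obtain ⟨v, L, hv₁, hv₂⟩ := h₁₂'.2 u J₁ J₂ h₁ h₂
  have hJ' : Φ.onV J₁ = Φ.onV J₃ := h₁.isPath.tgt_unique ((h₁₂.1.trans h₂₃.1) ▸ h₃.isPath)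
  obtain ⟨L₃, hv₃, -⟩ := hΦ.exists_liftsTo (I := J₃) (hJ' ▸ hv₁.isPath)
  exact (h₂₃'.2 (u ++ v) L L₃ (liftsTo_append.2 ⟨_, h₂, hv₂⟩)
    (liftsTo_append.2 ⟨_, h₃, hv₃⟩)).of_liftsTo hv₁ hv₃

/-- The stability relation as an equivalence relation. -/
def Hom.IsRightResolver.stableSetoid {Φ : Hom G H} (hΦ : Φ.IsRightResolver) : Setoid G.V where
  r := Φ.Stable
  iseqv :=
    { refl := fun _ => hΦ.stable_iff.2 ⟨rfl, fun _ _ _ h₁ h₂ =>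
        hΦ.liftsTo_unique h₁ h₂ ▸ Φ.mergeable_refl _⟩
      symm := fun h => hΦ.stable_iff.2 ⟨h.1.symm, fun u _ _ h₁ h₂ =>
        ((hΦ.stable_iff.1 h).2 u _ _ h₂ h₁).symm⟩
      trans := hΦ.stable_trans }

theorem Hom.IsRightResolver.stable_tgt {Φ : Hom G H} (hΦ : Φ.IsRightResolver) {a b : G.E}
    (h : Φ.Stable (G.src a) (G.src b)) (hab : Φ.onE a = Φ.onE b) :
    Φ.Stable (G.tgt a) (G.tgt b) := by
  refine hΦ.stable_iff.2 ⟨by rw [← Φ.tgt_onE, ← Φ.tgt_onE, hab], fun u J₁ J₂ h₁ h₂ => ?_⟩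
  exact (hΦ.stable_iff.1 h).2 ([Φ.onE a] ++ u) J₁ J₂ (liftsTo_append.2 ⟨_, liftsTo_singleton, h₁⟩)
    (liftsTo_append.2 ⟨_, hab ▸ liftsTo_singleton, h₂⟩)

/-! ### The quotient by the stability relation -/

section StableQuotient

variable {Φ : Hom G M} (hΦ : Φ.IsRightResolver)

theorem Hom.IsRightResolver.stable_out (I : G.V) :
    Φ.Stable (Quotient.mk hΦ.stableSetoid I).out I :=
  Quotient.exact (s := hΦ.stableSetoid) (Quotient.out_eq _)

/-- The quotient of `G` by the stability relation of `Φ : G → M`. Its edges are the pairs of a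
stability class and an edge of `M` leaving the image of that class. -/
noncomputable def Hom.IsRightResolver.stableQuotient : FinDigraph.{u} where
  V := Quotient hΦ.stableSetoid
  E := {z : Quotient hΦ.stableSetoid × M.E // M.src z.2 = Φ.onV z.1.out}
  src z := z.1.1
  tgt z := Quotient.mk _ (G.tgt (hΦ.exists_edge z.2).choose)
  finV := inferInstance
  finE := inferInstance

/-- The projection onto the quotient by the stability relation. -/
noncomputable def Hom.IsRightResolver.toStableQuotient : Hom G hΦ.stableQuotient where
  onV := Quotient.mk _
  onE a := ⟨(Quotient.mk _ (G.src a), Φ.onE a),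
    (Φ.src_onE a).trans (hΦ.stable_out _).1.symm⟩
  src_onE _ := rfl
  tgt_onE a := by
    refine Quotient.sound ?_
    have h := (hΦ.exists_edge (I := (Quotient.mk hΦ.stableSetoid (G.src a)).out) (x := Φ.onE a)
      ((Φ.src_onE a).trans (hΦ.stable_out _).1.symm)).choose_spec
    refine hΦ.stable_tgt ?_ h.2
    rw [h.1]
    exact hΦ.stable_out _

theorem Hom.IsRightResolver.isRightResolver_toStableQuotient :
    hΦ.toStableQuotient.IsRightResolver := by
  refine .of_existsUnique Quotient.mk_surjective (fun a b hs h => ?_) ?_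
  · exact hΦ.edge_unique hs (congrArg (fun z => z.1.2) h)
  · rintro I ⟨⟨c, x⟩, hx⟩ (rfl : c = _)
    obtain ⟨a, rfl, rfl⟩ := hΦ.exists_edge (I := I)
      (hx.trans (hΦ.stable_out I).1)
    exact ⟨a, rfl, rfl⟩

/-- Edges of the quotient are labelled by edges of `M` and stable vertices stay stable along a path
of `M`, so the lifts of such a path to two stable vertices have the same image in the quotient. -/
theorem Hom.IsRightResolver.map_toStableQuotient_eq {I₁ I₂ J₁ J₂ : G.V} {p₁ p₂ : List G.E}
    (hI : Φ.Stable I₁ I₂) (h₁ : G.IsPath I₁ p₁ J₁) (h₂ : G.IsPath I₂ p₂ J₂)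
    (h : p₁.map Φ.onE = p₂.map Φ.onE) :
    p₁.map hΦ.toStableQuotient.onE = p₂.map hΦ.toStableQuotient.onE := by
  induction p₁ generalizing I₁ I₂ p₂ with
  | nil => simp [List.map_eq_nil_iff.1 h.symm]
  | cons a p₁ ih =>
    obtain ⟨b, q, rfl, hb, hq⟩ := List.map_eq_cons_iff.1 h.symm
    obtain ⟨rfl, h₁⟩ := h₁
    obtain ⟨rfl, h₂⟩ := h₂
    rw [List.map_cons, List.map_cons, ih (hΦ.stable_tgt hI hb.symm) h₁ h₂ hq.symm]
    congr 1
    exact Subtype.ext (Prod.ext (Quotient.sound (s := hΦ.stableSetoid) hI) hb.symm)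

theorem Hom.IsRightResolver.isSynchronizing_toStableQuotient :
    hΦ.toStableQuotient.IsSynchronizing := by
  refine isSynchronizing_iff.2 ⟨hΦ.isRightResolver_toStableQuotient, fun I₁ I₂ hI => ?_⟩
  have hI : Φ.Stable I₁ I₂ := Quotient.exact (s := hΦ.stableSetoid) hI
  obtain ⟨v, J, ⟨p₁, h₁, rfl⟩, ⟨p₂, h₂, h⟩⟩ :=
    (hΦ.stable_iff.1 hI).2 [] _ _ ⟨[], rfl, rfl⟩ ⟨[], rfl, rfl⟩
  exact ⟨_, J, ⟨p₁, h₁, rfl⟩, ⟨p₂, h₂, hΦ.map_toStableQuotient_eq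
    (hΦ.stableSetoid.symm hI) h₂ h₁ h⟩⟩

theorem IsMinimalS.eq_of_stable (hG : G.IsMinimalS) (hΦ : Φ.IsRightResolver) {I₁ I₂ : G.V}
    (h : Φ.Stable I₁ I₂) : I₁ = I₂ := by
  obtain ⟨Ψ, hΨ, -⟩ := hG _ ⟨_, hΦ.isSynchronizing_toStableQuotient⟩
  have hbij : Function.Bijective (Quotient.mk hΦ.stableSetoid) :=
    (Nat.bijective_iff_surjective_and_card _).2
      ⟨Quotient.mk_surjective, (Nat.card_congr (Equiv.ofBijective _ hΨ)).symm⟩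
  exact hbij.1 (Quotient.sound h)

end StableQuotient

/-! ### Right resolvers from edge counts -/

theorem Hom.IsRightResolver.ncard_outEdges {X : Type*} {Φ : Hom G K} (hΦ : Φ.IsRightResolver)
    (g : K.V → X) (I : G.V) (d : X) :
    {e ∈ G.outEdges I | g (Φ.onV (G.tgt e)) = d}.ncard =
      {x ∈ K.outEdges (Φ.onV I) | g (K.tgt x) = d}.ncard := by
  rw [← ((hΦ.bijOn I).injOn.mono (Set.sep_subset _ _)).ncard_image]
  congr 1
  ext x
  constructor
  · rintro ⟨a, ⟨ha, hd⟩, rfl⟩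
    exact ⟨(hΦ.bijOn I).mapsTo ha, by rwa [Φ.tgt_onE]⟩
  · rintro ⟨hx, hd⟩
    obtain ⟨a, ha, rfl⟩ := (hΦ.bijOn I).surjOn hx
    exact ⟨a, ⟨ha, by rwa [Φ.tgt_onE] at hd⟩, rfl⟩

/-- A vertex map with the right edge counts is the vertex map of a right resolver. -/
theorem exists_isRightResolver_of_ncard (f : G.V → K.V) (hf : Function.Surjective f)
    (h : ∀ I J, {e ∈ G.outEdges I | f (G.tgt e) = J}.ncard =
      {x ∈ K.outEdges (f I) | K.tgt x = J}.ncard) :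
    ∃ Φ : Hom G K, Φ.onV = f ∧ Φ.IsRightResolver := by
  let ε : ∀ I J, {e ∈ G.outEdges I | f (G.tgt e) = J} ≃ {x ∈ K.outEdges (f I) | K.tgt x = J} :=
    fun I J => (Finite.card_eq.1 (h I J)).some
  let φ : G.E → K.E := fun e => (ε (G.src e) (f (G.tgt e)) ⟨e, rfl, rfl⟩).1
  have key : ∀ I J e (he : e ∈ {e ∈ G.outEdges I | f (G.tgt e) = J}), φ e = ε I J ⟨e, he⟩ := by
    rintro I J e ⟨rfl, rfl⟩
    rfl
  have htgt : ∀ e, K.tgt (φ e) = f (G.tgt e) :=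
    fun e => (ε (G.src e) (f (G.tgt e)) ⟨e, rfl, rfl⟩).2.2
  refine ⟨⟨f, φ, fun e => (ε (G.src e) (f (G.tgt e)) ⟨e, rfl, rfl⟩).2.1, htgt⟩, rfl,
    .of_existsUnique hf (fun a b hs hab => ?_) fun I x hx => ?_⟩
  · have hab : φ a = φ b := hab
    have ht : f (G.tgt a) = f (G.tgt b) := by rw [← htgt, ← htgt, hab]
    rw [key (G.src b) (f (G.tgt b)) a ⟨hs, ht⟩, key (G.src b) (f (G.tgt b)) b ⟨rfl, rfl⟩] at hab
    exact congrArg Subtype.val ((ε _ _).injective (Subtype.ext hab))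
  · let e := (ε I (K.tgt x)).symm ⟨x, hx, rfl⟩
    refine ⟨e.1, e.2.1, (key I (K.tgt x) e.1 e.2).trans ?_⟩
    simp [e]

/-! ### Minimal right resolving factors -/

/-- The quotient of `G` by an equivalence relation on its vertices whose edges are those leaving a
chosen representative of each class. -/
noncomputable def outQuotient (G : FinDigraph.{u}) (s : Setoid G.V) : FinDigraph.{u} where
  V := Quotient s
  E := {e : G.E // G.src e = (Quotient.mk s (G.src e)).out}
  src e := Quotient.mk s (G.src e.1)
  tgt e := Quotient.mk s (G.tgt e.1)
  finV := inferInstance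
  finE := inferInstance

theorem ncard_outQuotient (s : Setoid G.V) (c d : (G.outQuotient s).V) :
    {x ∈ (G.outQuotient s).outEdges c | (G.outQuotient s).tgt x = d}.ncard =
      {e ∈ G.outEdges (Quotient.out (s := s) c) | Quotient.mk s (G.tgt e) = d}.ncard := by
  rw [← Set.ncard_image_of_injective (f := fun x : (G.outQuotient s).E => x.1) _
    Subtype.val_injective]
  congr 1
  ext e
  constructor
  · rintro ⟨⟨e, he⟩, ⟨rfl, rfl⟩, rfl⟩
    exact ⟨he, rfl⟩
  · rintro ⟨he, rfl⟩
    have he : G.src e = Quotient.out (s := s) c := he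
    have hc : Quotient.mk s (G.src e) = c := by
      rw [he]
      exact Quotient.out_eq (s := s) c
    exact ⟨⟨e, he.trans (congrArg (Quotient.out (s := s)) hc).symm⟩, ⟨hc, rfl⟩, rfl⟩

/-- A right resolver to a `≤_R`-minimal graph factors, on vertices, through every right
resolver. The join of the two fiber partitions has well-defined edge counts, so its quotient is a
right resolving factor of `M`; by minimality of `M` this join is the fiber partition of `Φ`. -/
theorem IsMinimalR.exists_factor (hM : M.IsMinimalR) {Φ : Hom G M} (hΦ : Φ.IsRightResolver)
    {Ψ : Hom G H} (hΨ : Ψ.IsRightResolver) :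
    ∃ Θ : Hom H M, Θ.IsRightResolver ∧ ∀ I, Θ.onV (Ψ.onV I) = Φ.onV I := by
  let s : Setoid G.V := Setoid.ker Φ.onV ⊔ Setoid.ker Ψ.onV
  have hsΦ : ∀ I I', Φ.onV I = Φ.onV I' → Quotient.mk s I = Quotient.mk s I' := fun I I' h =>
    Quotient.sound ((le_sup_left : Setoid.ker Φ.onV ≤ s) h)
  have hsΨ : ∀ I I', Ψ.onV I = Ψ.onV I' → Quotient.mk s I = Quotient.mk s I' := fun I I' h =>
    Quotient.sound ((le_sup_right : Setoid.ker Ψ.onV ≤ s) h)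
  -- `s`-equivalent vertices have equally many edges into each `s`-class.
  let N : G.V → Quotient s → ℕ := fun I d =>
    {e ∈ G.outEdges I | Quotient.mk s (G.tgt e) = d}.ncard
  have hN : ∀ {L : FinDigraph.{u}} (Λ : Hom G L), Λ.IsRightResolver →
      (∀ I I', Λ.onV I = Λ.onV I' → Quotient.mk s I = Quotient.mk s I') →
      ∃ g : L.V → Quotient s, (∀ I, g (Λ.onV I) = Quotient.mk s I) ∧ ∀ I d,
        N I d = {x ∈ L.outEdges (Λ.onV I) | g (L.tgt x) = d}.ncard := by
    intro L Λ hΛ hs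
    let g : L.V → Quotient s := fun v => Quotient.mk s (Function.surjInv hΛ.surjective_onV v)
    have hg : ∀ I, g (Λ.onV I) = Quotient.mk s I := fun I =>
      hs _ _ (Function.surjInv_eq hΛ.surjective_onV _)
    refine ⟨g, hg, fun I d => ?_⟩
    rw [← hΛ.ncard_outEdges g I d]
    simp only [hg, N]
  obtain ⟨g, hg, hgN⟩ := hN Φ hΦ hsΦ
  obtain ⟨g', hg', hgN'⟩ := hN Ψ hΨ hsΨ
  have hNs : s ≤ Setoid.ker N := by
    refine sup_le (fun I I' h => ?_) (fun I I' h => ?_)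
    · have h : Φ.onV I = Φ.onV I' := h
      exact funext fun d => by rw [hgN, hgN, h]
    · have h : Ψ.onV I = Ψ.onV I' := h
      exact funext fun d => by rw [hgN', hgN', h]
  have hgsurj : Function.Surjective g := fun c => by
    obtain ⟨I, rfl⟩ := Quotient.mk_surjective c
    exact ⟨_, hg I⟩
  obtain ⟨Γ, -, hΓ⟩ := exists_isRightResolver_of_ncard (K := G.outQuotient s) g hgsurj
    fun m d => by
      obtain ⟨I, rfl⟩ := hΦ.surjective_onV m
      have hI : s I (g (Φ.onV I)).out := by
        rw [hg]
        exact Quotient.exact (Quotient.out_eq _).symm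
      exact ((hgN I d).symm.trans (congrFun (hNs hI) d)).trans (ncard_outQuotient s _ d).symm
  obtain ⟨Λ, hΛ, -⟩ := hM _ ⟨Γ, hΓ⟩
  have hginj : Function.Injective g :=
    ((Nat.bijective_iff_surjective_and_card g).2
      ⟨hgsurj, (Nat.card_congr (Equiv.ofBijective _ hΛ)).symm⟩).1
  have hker : ∀ I I', Ψ.onV I = Ψ.onV I' → Φ.onV I = Φ.onV I' := fun I I' h =>
    hginj (by rw [hg, hg, hsΨ I I' h])
  let f : H.V → M.V := fun v => Φ.onV (Function.surjInv hΨ.surjective_onV v)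
  have hf : ∀ I, f (Ψ.onV I) = Φ.onV I := fun I => hker _ _ (Function.surjInv_eq _ _)
  obtain ⟨Θ, hΘf, hΘ⟩ := exists_isRightResolver_of_ncard f
    (fun m => by
      obtain ⟨I, rfl⟩ := hΦ.surjective_onV m
      exact ⟨_, hf I⟩)
    (fun v J => by
      obtain ⟨I, rfl⟩ := hΨ.surjective_onV v
      rw [← hΨ.ncard_outEdges f I J, hf]
      simp only [hf]
      exact hΦ.ncard_outEdges id I J)
  exact ⟨Θ, hΘ, fun I => (congrFun hΘf _).trans (hf I)⟩

/-! ### Cliques of pairwise non-mergeable vertices -/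

/-- A set of vertices in one fiber of `Φ` no two of which are mergeable. -/
def Hom.IsClique (Φ : Hom G M) (A : Set G.V) : Prop :=
  ∀ a ∈ A, ∀ b ∈ A, Φ.onV a = Φ.onV b ∧ (Φ.Mergeable a b → a = b)

/-- A clique of maximum cardinality among the cliques in all fibers. -/
def Hom.IsMaxClique (Φ : Hom G M) (A : Set G.V) : Prop :=
  Φ.IsClique A ∧ ∀ B, Φ.IsClique B → B.ncard ≤ A.ncard

theorem Hom.isClique_singleton (Φ : Hom G M) (I : G.V) : Φ.IsClique {I} := by
  rintro a rfl b rfl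
  exact ⟨rfl, fun _ => rfl⟩

theorem Hom.IsMaxClique.image {Φ : Hom G M} {A : Set G.V}
    (hA : Φ.IsMaxClique A) {w : List M.E} {t : G.V → G.V}
    (ht : ∀ a ∈ A, Φ.LiftsTo a w (t a)) : Φ.IsMaxClique (t '' A) := by
  have hinj : Set.InjOn t A := fun a ha b hb h =>
    (hA.1 a ha b hb).2 ⟨w, t a, ht a ha, h ▸ ht b hb⟩
  refine ⟨?_, fun B hB => (hA.2 B hB).trans_eq hinj.ncard_image.symm⟩
  rintro _ ⟨a, ha, rfl⟩ _ ⟨b, hb, rfl⟩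
  refine ⟨(ht a ha).isPath.tgt_unique ((hA.1 a ha b hb).1 ▸ (ht b hb).isPath), fun h => ?_⟩
  rw [(hA.1 a ha b hb).2 (h.of_liftsTo (ht a ha) (ht b hb))]

theorem Hom.IsRightResolver.exists_liftsTo_clique {Φ : Hom G M} (hΦ : Φ.IsRightResolver)
    {A : Set G.V} (hA : Φ.IsClique A) {a : G.V} (ha : a ∈ A) {w : List M.E} {L : M.V}
    (hw : M.IsPath (Φ.onV a) w L) : ∃ t : G.V → G.V, ∀ b ∈ A, Φ.LiftsTo b w (t b) := by
  have : ∀ b, ∃ c, b ∈ A → Φ.LiftsTo b w c := fun b => by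
    by_cases hb : b ∈ A
    · obtain ⟨c, hc, -⟩ := hΦ.exists_liftsTo (I := b) ((hA a ha b hb).1 ▸ hw)
      exact ⟨c, fun _ => hc⟩
    · exact ⟨b, fun h => absurd h hb⟩
  choose t ht using this
  exact ⟨t, ht⟩

theorem Hom.IsRightResolver.exists_isMaxClique_mem {Φ : Hom G M} (hΦ : Φ.IsRightResolver)
    (hG : G.StronglyConnected) (p : G.V) : ∃ A, Φ.IsMaxClique A ∧ p ∈ A := by
  obtain ⟨A, hA, hmax⟩ := Set.exists_max_image {A | Φ.IsClique A} Set.ncard (Set.toFinite _)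
    ⟨{p}, Φ.isClique_singleton p⟩
  have hpos : 0 < A.ncard := by
    have := hmax {p} (Φ.isClique_singleton p)
    rw [Set.ncard_singleton] at this
    exact this
  obtain ⟨a, ha⟩ := (Set.ncard_pos (Set.toFinite _)).1 hpos
  obtain ⟨q, hq⟩ := hG a p
  obtain ⟨t, ht⟩ := hΦ.exists_liftsTo_clique hA ha (Φ.isPath_map hq)
  exact ⟨t '' A, IsMaxClique.image ⟨hA, hmax⟩ ht, a, ha,
    hΦ.liftsTo_unique (ht a ha) ⟨q, hq, rfl⟩⟩

/-- If two maximum cliques differ in a single vertex, the two odd vertices are stable: a path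
leading them to a non-mergeable pair would lead the union of the cliques to a larger clique. Here
the cliques are obtained from one maximum clique through `p` by two maps agreeing off `p`. -/
theorem Hom.IsRightResolver.stable_of_isMaxClique {Φ : Hom G M} (hΦ : Φ.IsRightResolver)
    {A : Set G.V} {p : G.V} (hp : p ∈ A) {t₁ t₂ : G.V → G.V} (h₁ : Φ.IsMaxClique (t₁ '' A))
    (h₂ : Φ.IsMaxClique (t₂ '' A)) (ht : ∀ a ∈ A, a ≠ p → t₁ a = t₂ a)
    (hinj : Set.InjOn t₂ A)
    (hfib : Φ.onV (t₁ p) = Φ.onV (t₂ p)) : Φ.Stable (t₁ p) (t₂ p) := by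
  refine hΦ.stable_iff.2 ⟨hfib, fun u J₁ J₂ hJ₁ hJ₂ => ?_⟩
  by_contra hJ
  have hp₁ : t₁ p ∈ t₁ '' A := ⟨p, hp, rfl⟩
  have hp₂ : t₂ p ∈ t₂ '' A := ⟨p, hp, rfl⟩
  obtain ⟨s, hs⟩ := hΦ.exists_liftsTo_clique h₁.1 hp₁ hJ₁.isPath
  have hB := h₁.image hs
  have hJfib : Φ.onV J₁ = Φ.onV J₂ := hJ₁.isPath.tgt_unique (hfib ▸ hJ₂.isPath)
  have hsp : s (t₁ p) = J₁ := hΦ.liftsTo_unique (hs _ hp₁) hJ₁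
  -- `J₂` lies over the same vertex as the clique `s '' (t₁ '' A)` and is mergeable with none of
  -- its vertices.
  have key : ∀ b ∈ s '' (t₁ '' A), Φ.onV b = Φ.onV J₂ ∧ ¬ Φ.Mergeable b J₂ := by
    rintro b hb
    refine ⟨((hB.1 b hb J₁ (hsp ▸ ⟨_, hp₁, rfl⟩)).1).trans hJfib, ?_⟩
    obtain ⟨_, ⟨a, ha, rfl⟩, rfl⟩ := hb
    by_cases hap : a = p
    · rwa [hap, hsp]
    · intro h
      have hs' := hs (t₁ a) ⟨a, ha, rfl⟩
      rw [ht a ha hap] at hs' h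
      exact hap (hinj ha hp ((h₂.1 _ ⟨a, ha, rfl⟩ _ hp₂).2 (h.of_liftsTo hs' hJ₂)))
  have hnot : J₂ ∉ s '' (t₁ '' A) := fun h => (key J₂ h).2 (Φ.mergeable_refl _)
  have hins : Φ.IsClique (insert J₂ (s '' (t₁ '' A))) := by
    rintro a (rfl | ha) b (rfl | hb)
    · exact ⟨rfl, fun _ => rfl⟩
    · exact ⟨(key b hb).1.symm, fun h => absurd h.symm (key b hb).2⟩
    · exact ⟨(key a ha).1, fun h => absurd h (key a ha).2⟩
    · exact hB.1 a ha b hb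
  have := hB.2 _ hins
  rw [Set.ncard_insert_of_notMem hnot] at this
  omega

/-! ### Recolouring and bunchy graphs -/

/-- All edges from a vertex of `G` into one fiber of `Φ` have the same terminal vertex. -/
def Hom.IsBunchy (Φ : Hom G M) : Prop :=
  ∀ a b, G.src a = G.src b → Φ.onV (G.tgt a) = Φ.onV (G.tgt b) → G.tgt a = G.tgt b

/-- The condition in `WeaklyAlmostBunchy`, for a fixed right resolver. -/
def Hom.IsWeaklyAlmostBunchy (Φ : Hom G M) : Prop :=
  ∀ I J : M.V, 2 ≤ (M.edgesBetween I J).ncard →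
    {I' : G.V | Φ.onV I' = I ∧
      (Φ.onV ⁻¹' {J} ∩ G.followers I').ncard = (M.edgesBetween I J).ncard}.Subsingleton

theorem preimage_inter_followers (f : G.V → M.V) (I : G.V) (J : M.V) :
    f ⁻¹' {J} ∩ G.followers I = G.tgt '' {e ∈ G.outEdges I | f (G.tgt e) = J} := by
  ext v
  constructor
  · rintro ⟨hv, e, he, rfl⟩
    exact ⟨e, ⟨he, hv⟩, rfl⟩
  · rintro ⟨e, ⟨he, hv⟩, rfl⟩
    exact ⟨hv, e, he, rfl⟩

/-- Permuting the images of the edges leaving each vertex, among parallel edges of `M`, gives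
another right resolver. -/
def Hom.recolour (Φ : Hom G M) (σ : G.V → Equiv.Perm M.E)
    (hσ : ∀ I x, M.src (σ I x) = M.src x ∧ M.tgt (σ I x) = M.tgt x) : Hom G M where
  onV := Φ.onV
  onE a := σ (G.src a) (Φ.onE a)
  src_onE a := (hσ _ _).1.trans (Φ.src_onE a)
  tgt_onE a := (hσ _ _).2.trans (Φ.tgt_onE a)

theorem Hom.IsRightResolver.recolour {Φ : Hom G M} (hΦ : Φ.IsRightResolver)
    (σ : G.V → Equiv.Perm M.E)
    (hσ : ∀ I x, M.src (σ I x) = M.src x ∧ M.tgt (σ I x) = M.tgt x) :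
    (Φ.recolour σ hσ).IsRightResolver := by
  refine .of_existsUnique hΦ.surjective_onV (fun a b hs h => ?_) fun I x hx => ?_
  · have h : σ (G.src a) (Φ.onE a) = σ (G.src b) (Φ.onE b) := h
    rw [hs] at h
    exact hΦ.edge_unique hs ((σ _).injective h)
  · obtain ⟨a, rfl, ha⟩ := hΦ.exists_edge (I := I) (x := (σ I).symm x) <| by
      rw [← (hσ I _).1, Equiv.apply_symm_apply]
      exact hx
    exact ⟨a, rfl, by simp [Hom.recolour, ha]⟩

theorem exists_perm_of_parallel {S : Set M.E} (hS : ∀ x ∈ S, ∀ y ∈ S, M.src x = M.src y ∧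
    M.tgt x = M.tgt y) {a b c d : M.E} (ha : a ∈ S) (hb : b ∈ S) (hc : c ∈ S) (hd : d ∈ S)
    (hab : a ≠ b) (hcd : c ≠ d) : ∃ σ : Equiv.Perm M.E, σ a = c ∧ σ b = d ∧
      ∀ x, M.src (σ x) = M.src x ∧ M.tgt (σ x) = M.tgt x := by
  classical
  have hswap : ∀ y ∈ S, ∀ z ∈ S, ∀ x, M.src (Equiv.swap y z x) = M.src x ∧
      M.tgt (Equiv.swap y z x) = M.tgt x := by
    intro y hy z hz x
    rw [Equiv.swap_apply_def]
    split_ifs with h₁ h₂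
    · exact h₁ ▸ hS z hz y hy
    · exact h₂ ▸ hS y hy z hz
    · exact ⟨rfl, rfl⟩
  have hb' : Equiv.swap a c b ∈ S := by
    rw [Equiv.swap_apply_def]
    split_ifs <;> assumption
  have hcb : c ≠ Equiv.swap a c b := fun h =>
    hab ((Equiv.swap a c).injective ((Equiv.swap_apply_left a c).trans h))
  refine ⟨(Equiv.swap a c).trans (Equiv.swap (Equiv.swap a c b) d), ?_, ?_, fun x => ?_⟩
  · rw [Equiv.trans_apply, Equiv.swap_apply_left, Equiv.swap_apply_of_ne_of_ne hcb hcd]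
  · rw [Equiv.trans_apply, Equiv.swap_apply_left]
  · have h₁ := hswap a ha c hc x
    have h₂ := hswap _ hb' d hd (Equiv.swap a c x)
    exact ⟨h₂.1.trans h₁.1, h₂.2.trans h₁.2⟩

/-- Choice of the vertex `p` at which two parallel edges of `M` are to be separated: `p` has two
edges over `J` to different vertices, and every other vertex in its fiber has two edges over `J` to
the same vertex. -/
theorem Hom.IsWeaklyAlmostBunchy.exists_vertex {Φ : Hom G M} (hw : Φ.IsWeaklyAlmostBunchy)
    (hΦ : Φ.IsRightResolver) (hb : ¬ Φ.IsBunchy) :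
    ∃ (p : G.V) (J : M.V), ∀ I, Φ.onV I = Φ.onV p → ∃ a b, a ≠ b ∧
      (G.src a = I ∧ Φ.onV (G.tgt a) = J) ∧ (G.src b = I ∧ Φ.onV (G.tgt b) = J) ∧
      (I = p ↔ G.tgt a ≠ G.tgt b) := by
  simp only [IsBunchy, not_forall] at hb
  obtain ⟨a, b, hs, hJ, hab⟩ := hb
  set J := Φ.onV (G.tgt b)
  let S : G.V → Set G.E := fun I => {e ∈ G.outEdges I | Φ.onV (G.tgt e) = J}
  have hS : ∀ I, (S I).ncard = (M.edgesBetween (Φ.onV I) J).ncard :=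
    fun I => hΦ.ncard_outEdges id I J
  have htwo : 2 ≤ (M.edgesBetween (Φ.onV (G.src b)) J).ncard := by
    rw [← hS]
    exact (Set.one_lt_ncard (Set.toFinite _)).2
      ⟨a, ⟨hs, hJ⟩, b, ⟨rfl, rfl⟩, fun h => hab (congrArg G.tgt h)⟩
  -- `p` has two different followers over `J` and is the only vertex in its fiber which may have
  -- the maximum number of them.
  obtain ⟨p, hp, ⟨c, d, hc, hd, hcd⟩, hmax⟩ : ∃ p, Φ.onV p = Φ.onV (G.src b) ∧
      (∃ c d, c ∈ S p ∧ d ∈ S p ∧ G.tgt c ≠ G.tgt d) ∧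
      ∀ I, Φ.onV I = Φ.onV p → (G.tgt '' S I).ncard = (S I).ncard → I = p := by
    have hw' := hw _ J htwo
    by_cases hfull : ∃ p, Φ.onV p = Φ.onV (G.src b) ∧ (G.tgt '' S p).ncard = (S p).ncard
    · obtain ⟨p, hp, hpS⟩ := hfull
      refine ⟨p, hp, ?_, fun I hI hIS => hw' ⟨hI.trans hp, ?_⟩ ⟨hp, ?_⟩⟩
      · rw [hS, hp] at hpS
        obtain ⟨_, ⟨c, hc, rfl⟩, _, ⟨d, hd, rfl⟩, hcd⟩ :=
          (Set.one_lt_ncard (Set.toFinite _)).1 (hpS ▸ htwo : 1 < (G.tgt '' S p).ncard)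
        exact ⟨c, d, hc, hd, hcd⟩
      · rw [preimage_inter_followers, ← hp, ← hI, ← hS]
        exact hIS
      · rw [preimage_inter_followers, ← hp, ← hS]
        exact hpS
    · exact ⟨_, rfl, ⟨a, b, ⟨hs, hJ⟩, ⟨rfl, rfl⟩, hab⟩, fun I hI hIS =>
        absurd ⟨I, hI, hIS⟩ hfull⟩
  refine ⟨p, J, fun I hI => ?_⟩
  by_cases hIp : I = p
  · subst hIp
    exact ⟨c, d, fun h => hcd (congrArg G.tgt h), hc, hd, by simp [hcd]⟩
  · have hinj : ¬ Set.InjOn G.tgt (S I) := fun h => hIp (hmax I hI h.ncard_image)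
    simp only [Set.InjOn, not_forall] at hinj
    obtain ⟨c, hc, d, hd, h, hne⟩ := hinj
    exact ⟨c, d, hne, hc, hd, by simp [hIp, h]⟩

/-- Over two suitable parallel edges `x`, `y` of `M`, the resolver can be recoloured so that the
lifts of `x` and `y` have different terminal vertices at exactly one vertex `p`. A maximum clique
through `p` then moves along `x` and along `y` to maximum cliques that differ in one vertex. -/
theorem Hom.IsWeaklyAlmostBunchy.exists_stable_ne {Φ : Hom G M} (hw : Φ.IsWeaklyAlmostBunchy)
    (hΦ : Φ.IsRightResolver) (hG : G.StronglyConnected) (hb : ¬ Φ.IsBunchy) :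
    ∃ Φ' : Hom G M, Φ'.IsRightResolver ∧ ∃ I₁ I₂, I₁ ≠ I₂ ∧ Φ'.Stable I₁ I₂ := by
  obtain ⟨p, J, h⟩ := hw.exists_vertex hΦ hb
  choose a b hab ha hb hp using h
  let x := Φ.onE (a p rfl)
  let y := Φ.onE (b p rfl)
  have hxy : x ≠ y := fun h => hab p rfl (hΦ.edge_unique ((ha p rfl).1.trans (hb p rfl).1.symm) h)
  let S := M.edgesBetween (Φ.onV p) J
  have hmem : ∀ e, Φ.onV (G.src e) = Φ.onV p → Φ.onV (G.tgt e) = J → Φ.onE e ∈ S :=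
    fun e h₁ h₂ => ⟨(Φ.src_onE e).trans h₁, (Φ.tgt_onE e).trans h₂⟩
  have hσ : ∀ I, ∃ σ : Equiv.Perm M.E, (∀ z, M.src (σ z) = M.src z ∧ M.tgt (σ z) = M.tgt z) ∧
      ∀ hI : Φ.onV I = Φ.onV p, σ (Φ.onE (a I hI)) = x ∧ σ (Φ.onE (b I hI)) = y := by
    intro I
    by_cases hI : Φ.onV I = Φ.onV p
    · obtain ⟨σ, h₁, h₂, h₃⟩ := exists_perm_of_parallel (S := S)
        (fun z hz z' hz' => ⟨hz.1.trans hz'.1.symm, hz.2.trans hz'.2.symm⟩)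
        (hmem (a I hI) (by rw [(ha I hI).1, hI]) (ha I hI).2)
        (hmem (b I hI) (by rw [(hb I hI).1, hI]) (hb I hI).2)
        (hmem (a p rfl) (by rw [(ha p rfl).1]) (ha p rfl).2)
        (hmem (b p rfl) (by rw [(hb p rfl).1]) (hb p rfl).2)
        (fun h => hab I hI (hΦ.edge_unique ((ha I hI).1.trans (hb I hI).1.symm) h)) hxy
      exact ⟨σ, h₃, fun _ => ⟨h₁, h₂⟩⟩
    · exact ⟨1, fun _ => ⟨rfl, rfl⟩, fun h => absurd h hI⟩
  choose σ hσM hσ using hσ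
  let Φ' := Φ.recolour σ hσM
  have hΦ' : Φ'.IsRightResolver := hΦ.recolour σ hσM
  obtain ⟨A, hA, hpA⟩ := hΦ'.exists_isMaxClique_mem hG p
  have hAp : ∀ I ∈ A, Φ.onV I = Φ.onV p := fun I hI => (hA.1 I hI p hpA).1
  have : ∀ I, ∃ J₁ J₂, (I ∈ A → Φ'.LiftsTo I [x] J₁ ∧ Φ'.LiftsTo I [y] J₂) ∧
      (I ∈ A → (I = p ↔ J₁ ≠ J₂)) := by
    intro I
    by_cases hI : I ∈ A
    · have hI' := hAp I hI
      refine ⟨G.tgt (a I hI'), G.tgt (b I hI'), fun _ => ⟨⟨[a I hI'], ⟨(ha I hI').1, rfl⟩, ?_⟩,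
        ⟨[b I hI'], ⟨(hb I hI').1, rfl⟩, ?_⟩⟩, fun _ => hp I hI'⟩
      · simp [Φ', Hom.recolour, (ha I hI').1, (hσ I hI').1]
      · simp [Φ', Hom.recolour, (hb I hI').1, (hσ I hI').2]
    · exact ⟨I, I, fun h => absurd h hI, fun h => absurd h hI⟩
  choose t₁ t₂ ht htp using this
  have ht₁ := fun I hI => (ht I hI).1
  have ht₂ := fun I hI => (ht I hI).2
  refine ⟨Φ', hΦ', t₁ p, t₂ p, (htp p hpA).1 rfl,
    hΦ'.stable_of_isMaxClique hpA (hA.image ht₁) (hA.image ht₂)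
    (fun I hI hne => by_contra fun h => hne ((htp I hI).2 h))
    (fun I hI I' hI' h => (hA.1 I hI I' hI').2 ⟨[y], t₂ I, ht₂ I hI, h ▸ ht₂ I' hI'⟩) ?_⟩
  have h₁ : M.tgt x = Φ'.onV (t₁ p) := (ht₁ p hpA).isPath.2
  have h₂ : M.tgt y = Φ'.onV (t₂ p) := (ht₂ p hpA).isPath.2
  rw [← h₁, ← h₂, Φ.tgt_onE, Φ.tgt_onE, (ha p rfl).2, (hb p rfl).2]

/-! ### Factors of weakly almost bunchy graphs -/

/-- Passing to a factor of `G` over `M` does not increase the number of followers over `J`, so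
every vertex with the maximum number in the factor comes from such a vertex of `G`. -/
theorem Hom.IsWeaklyAlmostBunchy.of_factor {Φ : Hom G M} (hw : Φ.IsWeaklyAlmostBunchy)
    (hΦ : Φ.IsRightResolver) {Ψ : Hom G H} (hΨ : Ψ.IsRightResolver) {Θ : Hom H M}
    (hΘ : ∀ I, Θ.onV (Ψ.onV I) = Φ.onV I) : Θ.IsWeaklyAlmostBunchy := by
  intro I J hIJ v hv v' hv'
  have key : ∀ K, Θ.onV (Ψ.onV K) = I →
      (Θ.onV ⁻¹' {J} ∩ H.followers (Ψ.onV K)).ncard = (M.edgesBetween I J).ncard →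
      Φ.onV K = I ∧ (Φ.onV ⁻¹' {J} ∩ G.followers K).ncard = (M.edgesBetween I J).ncard := by
    rintro K hK hcard
    have hK' : Φ.onV K = I := (hΘ K).symm.trans hK
    refine ⟨hK', le_antisymm ?_ (hcard ▸ ?_)⟩
    · rw [preimage_inter_followers, ← hK']
      exact (Set.ncard_image_le (Set.toFinite _)).trans_eq (hΦ.ncard_outEdges id K J)
    · refine (Set.ncard_le_ncard ?_ (Set.toFinite _)).trans
        (Set.ncard_image_le (f := Ψ.onV) (Set.toFinite _))
      rintro _ ⟨hJ, y, hy, rfl⟩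
      obtain ⟨e, he, rfl⟩ := hΨ.exists_edge hy
      rw [Ψ.tgt_onE] at hJ ⊢
      exact ⟨_, ⟨(hΘ _).symm.trans hJ, e, he, rfl⟩, rfl⟩
  obtain ⟨K, rfl⟩ := hΨ.surjective_onV v
  obtain ⟨K', rfl⟩ := hΨ.surjective_onV v'
  rw [hw I J hIJ (key K hv.1 hv.2) (key K' hv'.1 hv'.2)]

/-- In a bunchy graph the lift of a path of `M` visits vertices that depend on the vertices of the
path alone. So the image in `M` of a path of `G` from `I` to `J` lifts to a path from `Ψ I` to `Ψ J`
even though `Λ` agrees with `Θ` after `Ψ` only on vertices. -/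
theorem Hom.IsBunchy.liftsTo_of_isPath {Θ : Hom H M} (hb : Θ.IsBunchy) (hΘ : Θ.IsRightResolver)
    {Ψ : Hom G H} {Λ : Hom G M} (h : ∀ I, Θ.onV (Ψ.onV I) = Λ.onV I) {I J : G.V} {p : List G.E}
    (hp : G.IsPath I p J) : Θ.LiftsTo (Ψ.onV I) (p.map Λ.onE) (Ψ.onV J) := by
  induction p generalizing I with
  | nil => exact ⟨[], congrArg Ψ.onV hp, rfl⟩
  | cons e p ih =>
    obtain ⟨rfl, hp⟩ := hp
    obtain ⟨z, hz, hze⟩ := hΘ.exists_edge (I := Ψ.onV (G.src e)) (x := Λ.onE e)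
      ((Λ.src_onE e).trans (h _).symm)
    have hzt : H.tgt z = Ψ.onV (G.tgt e) := by
      rw [← Ψ.tgt_onE]
      refine hb z (Ψ.onE e) (hz.trans (Ψ.src_onE e).symm) ?_
      rw [← Θ.tgt_onE, hze, Λ.tgt_onE, Ψ.tgt_onE, h]
    refine liftsTo_append (u := [Λ.onE e]).2 ⟨_, ?_, ih hp⟩
    rw [← hzt, ← hz, ← hze]
    exact liftsTo_singleton

/-- For synchronizing factors `H₁`, `H₂` of `G` with `H₂` bunchy, vertices of `G` with the same
image in `H₁` have stable images in `H₂`. -/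
theorem Hom.IsBunchy.stable_of_isSynchronizing {H₁ H₂ : FinDigraph.{u}} {Ψ₁ : Hom G H₁}
    {Ψ₂ : Hom G H₂} {Θ₁ : Hom H₁ M} {Θ₂ : Hom H₂ M} (hb : Θ₂.IsBunchy)
    (hΘ₁ : Θ₁.IsRightResolver) (hΘ₂ : Θ₂.IsRightResolver) (hΨ₁ : Ψ₁.IsSynchronizing)
    (h : ∀ I, Θ₂.onV (Ψ₂.onV I) = Θ₁.onV (Ψ₁.onV I)) {I₁ I₂ : G.V}
    (hI : Ψ₁.onV I₁ = Ψ₁.onV I₂) : Θ₂.Stable (Ψ₂.onV I₁) (Ψ₂.onV I₂) := by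
  rw [isSynchronizing_iff] at hΨ₁
  have lift : ∀ {I J w}, Ψ₁.LiftsTo I w J →
      Θ₂.LiftsTo (Ψ₂.onV I) (w.map Θ₁.onE) (Ψ₂.onV J) := by
    rintro I J w ⟨p, hp, rfl⟩
    have := hb.liftsTo_of_isPath hΘ₂ (Λ := Θ₁.comp Ψ₁) h hp
    rwa [List.map_map]
  refine hΘ₂.stable_iff.2 ⟨by rw [h, h, hI], fun u J₁ J₂ hJ₁ hJ₂ => ?_⟩
  obtain ⟨L, ⟨w, hw, rfl⟩, -⟩ := hΘ₁.exists_liftsTo (h I₁ ▸ hJ₁.isPath)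
  obtain ⟨K₁, hK₁, rfl⟩ := hΨ₁.1.exists_liftsTo hw
  obtain ⟨K₂, hK₂, hK⟩ := hΨ₁.1.exists_liftsTo (hI ▸ hw)
  obtain rfl := hΘ₂.liftsTo_unique hJ₁ (lift hK₁)
  obtain rfl := hΘ₂.liftsTo_unique hJ₂ (lift hK₂)
  obtain ⟨v, J, hv₁, hv₂⟩ := hΨ₁.2 _ _ hK.symm
  exact ⟨_, _, lift hv₁, lift hv₂⟩

/-- A factor of `G` is determined up to isomorphism by the fibers of its vertex map, since these
determine the edge counts. -/
theorem Isomorphic.of_ker_eq {H₁ H₂ : FinDigraph.{u}} {Ψ₁ : Hom G H₁} {Ψ₂ : Hom G H₂}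
    (hΨ₁ : Ψ₁.IsRightResolver) (hΨ₂ : Ψ₂.IsRightResolver)
    (h : ∀ I₁ I₂, Ψ₁.onV I₁ = Ψ₁.onV I₂ ↔ Ψ₂.onV I₁ = Ψ₂.onV I₂) : H₁.Isomorphic H₂ := by
  let f : H₁.V → H₂.V := fun v => Ψ₂.onV (Function.surjInv hΨ₁.surjective_onV v)
  have hf : ∀ I, f (Ψ₁.onV I) = Ψ₂.onV I := fun I => (h _ _).1 (Function.surjInv_eq _ _)
  have hinj : Function.Injective f := fun v v' hv => by
    obtain ⟨I, rfl⟩ := hΨ₁.surjective_onV v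
    obtain ⟨I', rfl⟩ := hΨ₁.surjective_onV v'
    rw [hf, hf] at hv
    exact (h _ _).2 hv
  obtain ⟨Γ, hΓf, hΓ⟩ := exists_isRightResolver_of_ncard f
    (fun v => by
      obtain ⟨I, rfl⟩ := hΨ₂.surjective_onV v
      exact ⟨_, hf I⟩)
    (fun v J => by
      obtain ⟨I, rfl⟩ := hΨ₁.surjective_onV v
      rw [← hΨ₁.ncard_outEdges f I J, hf]
      simp only [hf]
      exact hΨ₂.ncard_outEdges id I J)
  rw [← hΓf] at hinj
  exact ⟨Γ, ⟨hinj, hΓ.surjective_onV⟩, hΓ.bijective_onE hinj⟩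

theorem exists_isMinimalS (G : FinDigraph.{u}) : ∃ O, LeS O G ∧ O.IsMinimalS := by
  obtain ⟨O, hO, hmin⟩ := exists_minimalFor_of_wellFoundedLT (fun O => LeS O G)
    (fun O : FinDigraph.{u} => Nat.card O.V) ⟨G, LeS.refl G⟩
  refine ⟨O, hO, fun K hK => ?_⟩
  have hle : Nat.card O.V ≤ Nat.card K.V := by
    by_contra! hlt
    exact hlt.not_ge (hmin (hK.trans hO) hlt.le)
  obtain ⟨Φ, hΦ, -⟩ := hK
  have hbij : Function.Bijective Φ.onV := (Nat.bijective_iff_surjective_and_card _).2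
    ⟨hΦ.surjective_onV, hle.antisymm (Nat.card_le_card_of_surjective _ hΦ.surjective_onV)⟩
  exact Isomorphic.symm ⟨Φ, hbij, hΦ.bijective_onE hbij.1⟩

end FinDigraph

theorem mainTheorem2 (G : FinDigraph.{u}) (hconn : G.StronglyConnected)
    (hwab : G.WeaklyAlmostBunchy) :
    ∃ O : FinDigraph.{u}, (FinDigraph.LeS O G ∧ O.IsMinimalS) ∧
      ∀ H : FinDigraph.{u}, FinDigraph.LeS H G → H.IsMinimalS → FinDigraph.Isomorphic H O := by
  obtain ⟨M, Φ, hM, hΦ, hw⟩ := hwab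
  -- A `≤_S`-minimal factor of `G` lies over `M` as a bunchy graph.
  have key : ∀ (H : FinDigraph.{u}) (Ψ : FinDigraph.Hom G H), Ψ.IsSynchronizing → H.IsMinimalS →
      ∃ Θ : FinDigraph.Hom H M, Θ.IsRightResolver ∧ Θ.IsBunchy ∧
        ∀ I, Θ.onV (Ψ.onV I) = Φ.onV I := by
    intro H Ψ hΨ hH
    obtain ⟨Θ, hΘ, hΘΨ⟩ := hM.exists_factor hΦ hΨ.1
    refine ⟨Θ, hΘ, by_contra fun hb => ?_, hΘΨ⟩
    have hwΘ := FinDigraph.Hom.IsWeaklyAlmostBunchy.of_factor hw hΦ hΨ.1 hΘΨ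
    obtain ⟨Θ', hΘ', I₁, I₂, hne, hst⟩ := hwΘ.exists_stable_ne hΘ
      (hconn.of_surjective Ψ hΨ.1.surjective_onV) hb
    exact hne (hH.eq_of_stable hΘ' hst)
  obtain ⟨O, ⟨Ψ, hΨ⟩, hO⟩ := G.exists_isMinimalS
  refine ⟨O, ⟨⟨Ψ, hΨ⟩, hO⟩, ?_⟩
  rintro H ⟨Ψ', hΨ'⟩ hH
  obtain ⟨Θ, hΘ, hΘb, hΘΨ⟩ := key O Ψ hΨ hO
  obtain ⟨Θ', hΘ', hΘb', hΘΨ'⟩ := key H Ψ' hΨ' hH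
  refine FinDigraph.Isomorphic.of_ker_eq hΨ'.1 hΨ.1 fun I₁ I₂ => ⟨fun h => ?_, fun h => ?_⟩
  · exact hO.eq_of_stable hΘ (hΘb.stable_of_isSynchronizing hΘ' hΘ hΨ'
      (fun I => (hΘΨ I).trans (hΘΨ' I).symm) h)
  · exact hH.eq_of_stable hΘ' (hΘb'.stable_of_isSynchronizing hΘ hΘ' hΨ
      (fun I => (hΘΨ' I).trans (hΘΨ I).symm) h)
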